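/- For a partition $\pi=(\lambda_1\ge\lambda_2\ge\dots)$ and a positive integer $t$, label the cell in row $i$ and column $j$ of the Young diagram of $\pi$ by the least non-negative integer congruent to $j-i$ modulo $t$, let $r_s(\pi,t)$ be the number of cells labelled $s$, and define the GBG-rank of $\pi$ mod $t$ by $\mathrm{GBG}^{(t)}(\pi)=\sum_{s=0}^{t-1} r_s(\pi,t)\,\omega_t^{\,s}$, where $\omega_t=e^{2\pi \sqrt{-1}/t}$. Let $\tilde G_{M,t}(k,q)=\sum_{\pi} q^{|\pi|}$, where the sum runs over all partitions $\pi$ whose parts are all at most $M$, in which no part occurs more than $t-1$ times, and for which $\mathrm{GBG}^{(t)}(\pi)=k$. Write $(a;q)_L=\prod_{i=0}^{L-1}(1-aq^i)$ for integers $L\ge 0$. **Theorem 2.4.** Let $t$ be a prime, $N\ge 0$ an integer, $\nu\in\{0,1,\dots,t-1\}$ and $k$ any integer, and put $\tilde q=q^t$ and $(\tilde q)_L=(\tilde q;\tilde q)_L$. Then, as formal power series in $q$, $$\tilde G_{tN+\nu,t}(k,q)=\frac{q^{tk^2-(t-1)k}\,(\tilde q)_{tN+\nu}}{(\tilde q)_{N+\lceil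 \nu/t\rceil-k}\;\Bigl(\prod_{i=1}^{t-2}(\tilde q)_{N+\lceil(\nu-i)/t\rceil}\Bigr)\;(\tilde q)_{N+k}},$$ where $1/(\tilde q)_m$ is read as $0$ for negative integers $m$ (so both sides are $0$ if $k>N+\lceil \nu/t\rceil$ or $k<-N$), and where the product over $i$ is empty for $t=2$. -/

import Mathlib

open scoped PowerSeries

noncomputable section

namespace GBG

/-- The length of row `i` (rows are numbered from `0`) of the Young diagram of `π`: the `i`-th
entry of the list of parts in non-increasing order, and `0` below the last row. -/
def rowLength {n : ℕ} (π : n.Partition) (i : ℕ) : ℕ :=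
  (π.parts.sort (· ≥ ·)).getD i 0

/-- `r_j(π, t)`: the number of cells of the Young diagram of `π` whose label is `j`. The cell in
row `i` and column `c` is labelled by the least non-negative integer congruent to `c - i` modulo
`t`; numbering both rows and columns from `0` instead of `1` does not change `c - i`. -/
def residueCount {n : ℕ} (t : ℕ) (π : n.Partition) (j : ℕ) : ℕ :=
  ∑ i ∈ Finset.range π.parts.card,
    ((Finset.range (rowLength π i)).filter
      (fun c : ℕ => ((c : ℤ) - (i : ℤ)) % (t : ℤ) = (j : ℤ))).card

/-- The GBG-rank of `π` modulo `t`: the complex number `∑_{j=0}^{t-1} r_j(π, t) ω^j` with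
`ω = exp(2πi/t)`. -/
def gbgRank {n : ℕ} (t : ℕ) (π : n.Partition) : ℂ :=
  ∑ j ∈ Finset.range t,
    (residueCount t π j : ℂ) * Complex.exp (2 * Real.pi * Complex.I / t) ^ j

open Classical in
/-- The generating function, as a formal power series in `q = X`, of the partitions all of whose
parts are at most `M`, in which every part occurs at most `t - 1` times, and whose GBG-rank
modulo `t` is equal to `k`: the coefficient of `q ^ n` is the number of such partitions of `n`. -/
def genFun (t M : ℕ) (k : ℤ) : ℚ⟦X⟧ :=
  PowerSeries.mk fun n =>
    (((Finset.univ : Finset n.Partition).filter fun π =>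
      (∀ p ∈ π.parts, p ≤ M) ∧ (∀ p ∈ π.parts, π.parts.count p ≤ t - 1) ∧
        gbgRank t π = (k : ℂ)).card : ℚ)

/-- The `q`-shifted factorial `(a; b)_L = ∏_{i=0}^{L-1} (1 - a b^i)` of formal power series. -/
def qPoch (a b : ℚ⟦X⟧) (L : ℕ) : ℚ⟦X⟧ :=
  ∏ i ∈ Finset.range L, (1 - a * b ^ i)

/-- The reciprocal `1 / (q^t; q^t)_m` for an integer `m`, with the usual convention that it is
`0` for negative `m`. For `m ≥ 0` and `t ≥ 1` the series `(q^t; q^t)_m` has constant term `1`, so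
`⁻¹` is its inverse in the ring of formal power series. -/
def qPochInv (t : ℕ) (m : ℤ) : ℚ⟦X⟧ :=
  if 0 ≤ m then (qPoch (PowerSeries.X ^ t) (PowerSeries.X ^ t) m.toNat)⁻¹ else 0

/-- The exponent of `q` in the numerator is a non-negative integer, so reading it as a natural
number loses nothing. -/
theorem exponent_nonneg (t : ℕ) (ht : 1 ≤ t) (k : ℤ) :
    0 ≤ (t : ℤ) * k ^ 2 - ((t : ℤ) - 1) * k := by
  have h1 : (1 : ℤ) ≤ t := by exact_mod_cast ht
  have h2 : 0 ≤ k ^ 2 - k := by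
    rcases le_or_gt k 0 with h | h
    · nlinarith
    · nlinarith
  nlinarith [sq_nonneg k, mul_nonneg (sub_nonneg.mpr h1) h2]

end GBG

end

open scoped PowerSeries

noncomputable section

namespace GBG

open Finset

/-- The weight of a runner with residue `u` carrying `m` beads: the generating function of the
sums of the `m`-element subsets of `u + t ℕ`. -/
def runnerWeight (t u : ℕ) (m : ℤ) : ℚ⟦X⟧ :=
  if 0 ≤ m then PowerSeries.X ^ (u * m.toNat + t * m.toNat.choose 2) * qPochInv t m else 0

theorem runnerWeight_of_neg {t u : ℕ} {m : ℤ} (hm : m < 0) : runnerWeight t u m = 0 :=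
  if_neg (not_le.mpr hm)

theorem runnerWeight_of_nonneg {t u : ℕ} {m : ℤ} (hm : 0 ≤ m) :
    runnerWeight t u m =
      PowerSeries.X ^ (u * m.toNat + t * m.toNat.choose 2) * qPochInv t m :=
  if_pos hm

theorem runnerWeight_natCast (t u m : ℕ) :
    runnerWeight t u m = PowerSeries.X ^ (u * m + t * m.choose 2) * qPochInv t m := by
  simp [runnerWeight]

theorem runnerWeight_succ (t u m : ℕ) :
    runnerWeight t (u + 1) m = PowerSeries.X ^ m * runnerWeight t u m := by
  rw [runnerWeight_natCast, runnerWeight_natCast]; ring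

theorem constantCoeff_qPoch {t : ℕ} (ht : 0 < t) (m : ℕ) :
    PowerSeries.constantCoeff (qPoch (PowerSeries.X ^ t) (PowerSeries.X ^ t) m) = 1 := by
  simp [qPoch, map_prod, ht.ne']

theorem qPoch_succ (a b : ℚ⟦X⟧) (m : ℕ) :
    qPoch a b (m + 1) = qPoch a b m * (1 - a * b ^ m) :=
  Finset.prod_range_succ _ _

theorem qPochInv_zero (t : ℕ) : qPochInv t 0 = 1 := by
  simp [qPochInv, qPoch]

theorem qPochInv_of_neg {t : ℕ} {m : ℤ} (hm : m < 0) : qPochInv t m = 0 :=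
  if_neg (not_le.mpr hm)

theorem qPochInv_succ {t : ℕ} (ht : 0 < t) (m : ℕ) :
    qPochInv t ((m + 1 : ℕ) : ℤ) * (1 - PowerSeries.X ^ (t * (m + 1))) = qPochInv t m := by
  have h1 : (0 : ℤ) ≤ ((m + 1 : ℕ) : ℤ) := Int.natCast_nonneg _
  have h2 : (0 : ℤ) ≤ (m : ℤ) := Int.natCast_nonneg _
  unfold qPochInv
  rw [if_pos h1, if_pos h2, Int.toNat_natCast, Int.toNat_natCast]
  have e1 := PowerSeries.inv_mul_cancel (qPoch (PowerSeries.X ^ t) (PowerSeries.X ^ t) (m + 1))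
    (by rw [constantCoeff_qPoch ht]; exact one_ne_zero)
  have e2 := PowerSeries.mul_inv_cancel (qPoch (PowerSeries.X ^ t) (PowerSeries.X ^ t) m)
    (by rw [constantCoeff_qPoch ht]; exact one_ne_zero)
  set A := (qPoch (PowerSeries.X ^ t) (PowerSeries.X ^ t) (m + 1))⁻¹
  set B := (qPoch (PowerSeries.X ^ t) (PowerSeries.X ^ t) m)⁻¹
  rw [qPoch_succ] at e1
  have e3 : (PowerSeries.X ^ t : ℚ⟦X⟧) * (PowerSeries.X ^ t) ^ m = PowerSeries.X ^ (t * (m + 1)) := by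
    ring
  rw [e3] at e1
  calc A * (1 - PowerSeries.X ^ (t * (m + 1)))
      = A * (1 - PowerSeries.X ^ (t * (m + 1))) *
          (qPoch (PowerSeries.X ^ t) (PowerSeries.X ^ t) m * B) := by rw [e2, mul_one]
    _ = A * (qPoch (PowerSeries.X ^ t) (PowerSeries.X ^ t) m *
          (1 - PowerSeries.X ^ (t * (m + 1)))) * B := by ring
    _ = B := by rw [e1, one_mul]

theorem runnerWeight_zero_succ {t : ℕ} (ht : 0 < t) (m : ℕ) :
    runnerWeight t 0 ((m + 1 : ℕ) : ℤ) =
      PowerSeries.X ^ (m + 1) * runnerWeight t (t - 1) ((m + 1 : ℕ) : ℤ) +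
        PowerSeries.X ^ m * runnerWeight t (t - 1) m := by
  obtain ⟨s, rfl⟩ : ∃ s, t = s + 1 := ⟨t - 1, by omega⟩
  rw [runnerWeight_natCast, runnerWeight_natCast, runnerWeight_natCast, ← qPochInv_succ ht m,
    Nat.choose_succ_succ' m 1, Nat.choose_one_right, Nat.add_sub_cancel]
  ring

/-- The generating function of the sums of the sets of naturals which, for every `u : ZMod t`,
contain exactly `m u` elements congruent to `u`. -/
def beadWeight (t : ℕ) [NeZero t] (m : ZMod t → ℤ) : ℚ⟦X⟧ :=
  ∏ u, runnerWeight t u.val (m u)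

theorem beadWeight_of_neg {t : ℕ} [NeZero t] {m : ZMod t → ℤ} {u : ZMod t} (h : m u < 0) :
    beadWeight t m = 0 :=
  Finset.prod_eq_zero (mem_univ u) (runnerWeight_of_neg h)

theorem beadWeight_shift (t : ℕ) [NeZero t] (m : ZMod t → ℤ) :
    beadWeight t (fun u => m (u + 1)) = ∏ u : ZMod t, runnerWeight t (u - 1).val (m u) := by
  unfold beadWeight
  exact Fintype.prod_equiv (Equiv.addRight 1) _ _ (by simp)

theorem val_sub_one_of_ne_zero {t : ℕ} [NeZero t] {u : ZMod t} (hu : u ≠ 0) :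
    u.val = (u - 1).val + 1 := by
  obtain ⟨s, rfl⟩ : ∃ s, t = s + 1 := ⟨t - 1, by have := NeZero.pos t; omega⟩
  have h := Fin.val_sub_one_of_ne_zero (i := (u : Fin (s + 1))) hu
  have h2 : u.val ≠ 0 := by rwa [Ne, ZMod.val_eq_zero]
  change u.val = Fin.val (u - 1) + 1
  have h3 : Fin.val (u - 1) = u.val - 1 := h
  omega

theorem val_zero_sub_one (t : ℕ) [NeZero t] : ((0 : ZMod t) - 1).val = t - 1 := by
  obtain ⟨s, rfl⟩ : ∃ s, t = s + 1 := ⟨t - 1, by have := NeZero.pos t; omega⟩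
  rw [zero_sub, ZMod.val_neg_one]; rfl

/-- Splitting sets of naturals according to whether they contain `0`. -/
theorem beadWeight_eq_add (t : ℕ) [NeZero t] (M : ℕ) (m : ZMod t → ℤ)
    (hm : ∑ u, m u = (M + 1 : ℕ)) :
    beadWeight t m = PowerSeries.X ^ (M + 1) * beadWeight t (fun u => m (u + 1)) +
      PowerSeries.X ^ M *
        beadWeight t (fun u => m (u + 1) - if u + 1 = 0 then 1 else 0) := by
  rw [beadWeight_shift t m, beadWeight_shift t (fun u => m u - if u = 0 then 1 else 0)]
  by_cases hneg : ∃ u, m u < 0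
  · obtain ⟨u, hu⟩ := hneg
    rw [beadWeight_of_neg hu, Finset.prod_eq_zero (mem_univ u) (runnerWeight_of_neg hu),
      Finset.prod_eq_zero (mem_univ u) (runnerWeight_of_neg (by split_ifs <;> omega))]
    simp
  push Not at hneg
  lift m to ZMod t → ℕ using hneg
  beta_reduce at hm ⊢
  have hM : ∑ u, m u = M + 1 := by exact_mod_cast hm
  rw [beadWeight, ← Finset.mul_prod_erase _ _ (mem_univ (0 : ZMod t)),
    ← Finset.mul_prod_erase _ _ (mem_univ (0 : ZMod t)),
    ← Finset.mul_prod_erase _ _ (mem_univ (0 : ZMod t))]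
  rw [← Finset.add_sum_erase _ _ (mem_univ (0 : ZMod t))] at hM
  have h1 : ∏ u ∈ univ.erase (0 : ZMod t), runnerWeight t u.val (m u) =
      PowerSeries.X ^ (∑ u ∈ univ.erase (0 : ZMod t), m u) *
        ∏ u ∈ univ.erase (0 : ZMod t), runnerWeight t (u - 1).val (m u) := by
    rw [← Finset.prod_pow_eq_pow_sum, ← Finset.prod_mul_distrib]
    refine Finset.prod_congr rfl fun u hu => ?_
    rw [val_sub_one_of_ne_zero (Finset.ne_of_mem_erase hu), runnerWeight_succ]
  have h2 : ∏ u ∈ univ.erase (0 : ZMod t),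
        runnerWeight t (u - 1).val ((m u : ℤ) - if u = 0 then 1 else 0) =
      ∏ u ∈ univ.erase (0 : ZMod t), runnerWeight t (u - 1).val (m u) := by
    refine Finset.prod_congr rfl fun u hu => ?_
    rw [if_neg (Finset.ne_of_mem_erase hu), sub_zero]
  rw [h1, h2, val_zero_sub_one, ZMod.val_zero, if_pos rfl]
  set S := ∑ u ∈ univ.erase (0 : ZMod t), m u
  set Q := ∏ u ∈ univ.erase (0 : ZMod t), runnerWeight t (u - 1).val (m u)
  rcases h0 : m 0 with _ | a
  · rw [h0] at hM
    rw [runnerWeight_of_neg (m := ((0 : ℕ) : ℤ) - 1) (by simp), ← hM, runnerWeight_natCast,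
      runnerWeight_natCast]
    simp only [qPochInv_zero, Nat.cast_zero]
    simp
  · rw [h0] at hM
    have e : M = a + S := by omega
    rw [runnerWeight_zero_succ (NeZero.pos t), e]
    have e2 : ((a + 1 : ℕ) : ℤ) - 1 = a := by push_cast; ring
    rw [e2]
    ring

theorem sum_beadWeight_rotations (t : ℕ) [NeZero t] (M : ℕ) (m : ZMod t → ℤ)
    (hm : ∑ u, m u = (M + 1 : ℕ)) :
    ∑ j ∈ range t, PowerSeries.X ^ ((M + 1) * j) * (PowerSeries.X ^ M *
        beadWeight t (fun u => m (u + 1 + j) - if u + 1 = 0 then 1 else 0)) =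
      (1 - PowerSeries.X ^ (t * (M + 1))) * beadWeight t m := by
  have key : ∀ j : ℕ, PowerSeries.X ^ ((M + 1) * j) * (PowerSeries.X ^ M *
        beadWeight t (fun u => m (u + 1 + j) - if u + 1 = 0 then 1 else 0)) =
      PowerSeries.X ^ ((M + 1) * j) * beadWeight t (fun u => m (u + j)) -
      PowerSeries.X ^ ((M + 1) * (j + 1)) *
        beadWeight t (fun u => m (u + (j + 1 : ℕ))) := by
    intro j
    have h := beadWeight_eq_add t M (fun u => m (u + j)) (by
      rw [← hm]; exact Fintype.sum_equiv (Equiv.addRight (j : ZMod t)) _ _ (by simp))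
    rw [h]
    have e : ∀ u : ZMod t, u + 1 + (j : ZMod t) = u + (j + 1 : ℕ) := by
      intro u; push_cast; ring
    simp only [e]
    ring
  rw [Finset.sum_congr rfl fun j _ => key j, Finset.sum_range_sub']
  simp
  ring

/-- The non-increasing lists of positive integers that are at most `M`, in which no entry occurs
`t` times or more. -/
def boundedLists (t : ℕ) : ℕ → Finset (List ℕ)
  | 0 => {[]}
  | M + 1 => (range t ×ˢ boundedLists t M).image fun x => List.replicate x.1 (M + 1) ++ x.2

theorem exists_eq_replicate_append {p : ℕ} : ∀ {L : List ℕ}, L.Pairwise (· ≥ ·) →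
    (∀ x ∈ L, x ≤ p) → ∃ (j : ℕ) (L' : List ℕ), L = List.replicate j p ++ L' ∧ ∀ x ∈ L', x < p
  | [], _, _ => ⟨0, [], rfl, by simp⟩
  | a :: L, h, hp => by
    rw [List.pairwise_cons] at h
    rcases (hp a List.mem_cons_self).eq_or_lt with rfl | ha
    · obtain ⟨j, L', rfl, hL'⟩ := exists_eq_replicate_append h.2
        fun x hx => hp x (List.mem_cons_of_mem _ hx)
      exact ⟨j + 1, L', rfl, hL'⟩
    · refine ⟨0, a :: L, rfl, fun x hx => ?_⟩
      rcases List.mem_cons.mp hx with rfl | hx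
      · exact ha
      · exact (h.1 x hx).trans_lt ha

theorem mem_boundedLists {t : ℕ} (ht : 0 < t) : ∀ {M : ℕ} {L : List ℕ},
    L ∈ boundedLists t M ↔
      L.Pairwise (· ≥ ·) ∧ (∀ p ∈ L, 0 < p ∧ p ≤ M) ∧ ∀ p ∈ L, L.count p < t
  | 0, L => by
    rw [boundedLists, mem_singleton]
    constructor
    · rintro rfl; simp
    · rintro ⟨-, h, -⟩
      refine List.eq_nil_iff_forall_not_mem.mpr fun p hp => ?_
      have := h p hp
      omega
  | M + 1, L => by
    simp only [boundedLists, mem_image, mem_product, mem_range, Prod.exists]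
    constructor
    · rintro ⟨j, L', ⟨hj, hL'⟩, rfl⟩
      obtain ⟨h1, h2, h3⟩ := (mem_boundedLists ht).mp hL'
      refine ⟨List.pairwise_append.mpr ⟨List.pairwise_replicate.mpr (Or.inr le_rfl), h1, ?_⟩,
        ?_, ?_⟩
      · intro a ha b hb
        rw [List.eq_of_mem_replicate ha]
        exact (h2 b hb).2.trans (Nat.le_succ M)
      · intro p hp
        rcases List.mem_append.mp hp with hp | hp
        · rw [List.eq_of_mem_replicate hp]; omega
        · have := h2 p hp; omega
      · intro p hp
        rw [List.count_append, List.count_replicate]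
        by_cases hpM : p = M + 1
        · subst hpM
          rw [List.count_eq_zero_of_not_mem fun h => by have := h2 _ h; omega]
          simpa using hj
        · rw [if_neg (by simpa using fun h => hpM h.symm), zero_add]
          rcases List.mem_append.mp hp with hp | hp
          · exact absurd (List.eq_of_mem_replicate hp) hpM
          · exact h3 p hp
    · rintro ⟨h1, h2, h3⟩
      obtain ⟨j, L', rfl, hL'⟩ := exists_eq_replicate_append h1 fun x hx => (h2 x hx).2
      refine ⟨j, L', ⟨?_, (mem_boundedLists ht).mpr ⟨(List.pairwise_append.mp h1).2.1, ?_, ?_⟩⟩,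
        rfl⟩
      · rcases Nat.eq_zero_or_pos j with rfl | hj
        · exact ht
        · have := h3 (M + 1) (List.mem_append_left _ (List.mem_replicate.mpr ⟨hj.ne', rfl⟩))
          rw [List.count_append, List.count_replicate_self] at this
          omega
      · intro p hp
        have h := h2 p (List.mem_append_right _ hp)
        have h' := hL' p hp
        omega
      · intro p hp
        have := h3 p (List.mem_append_right _ hp)
        rw [List.count_append] at this
        omega

theorem sum_boundedLists_succ {t : ℕ} (ht : 0 < t) {M : ℕ} {R : Type*} [AddCommMonoid R]
    (f : List ℕ → R) :
    ∑ L ∈ boundedLists t (M + 1), f L =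
      ∑ j ∈ range t, ∑ L ∈ boundedLists t M, f (List.replicate j (M + 1) ++ L) := by
  rw [boundedLists, Finset.sum_image, Finset.sum_product]
  rintro ⟨j, L⟩ hx ⟨j', L'⟩ hx' h
  rw [Finset.mem_coe, mem_product] at hx hx'
  have hc : ∀ {L : List ℕ}, L ∈ boundedLists t M → L.count (M + 1) = 0 := fun hL =>
    List.count_eq_zero_of_not_mem fun h => by
      have := ((mem_boundedLists ht).mp hL).2.1 _ h
      omega
  have hj : j = j' := by
    have := congrArg (List.count (M + 1)) h
    simpa [List.count_append, hc hx.2, hc hx'.2] using this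
  subst hj
  exact Prod.ext rfl (List.append_cancel_left h)

/-- The sum of `ω ^ (c - i)` over the cells in row `i` and column `c` of a list of rows. -/
def listRank (ω : ℂ) : List ℕ → ℂ
  | [] => 0
  | p :: L => ∑ c ∈ range p, ω ^ c + ω⁻¹ * listRank ω L

theorem listRank_eq_sum {ω : ℂ} (hω : ω ≠ 0) : ∀ L : List ℕ,
    listRank ω L = ∑ i ∈ range L.length, ∑ c ∈ range (L.getD i 0), ω ^ ((c : ℤ) - (i : ℤ))
  | [] => by simp [listRank]
  | p :: L => by
    rw [listRank, listRank_eq_sum hω L, List.length_cons, Finset.sum_range_succ', add_comm,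
      Finset.mul_sum]
    congr 1
    · refine Finset.sum_congr rfl fun i _ => ?_
      rw [Finset.mul_sum]
      refine Finset.sum_congr (by simp) fun c _ => ?_
      rw [← zpow_neg_one, ← zpow_add₀ hω]
      congr 1
      push_cast
      ring

theorem gbgRank_eq_listRank {n t : ℕ} (ht : 0 < t) (π : n.Partition) :
    gbgRank t π =
      listRank (Complex.exp (2 * Real.pi * Complex.I / t)) (π.parts.sort (· ≥ ·)) := by
  have hprim := Complex.isPrimitiveRoot_exp t ht.ne'
  set ω := Complex.exp (2 * Real.pi * Complex.I / t)
  have htz : (t : ℤ) ≠ 0 := by exact_mod_cast ht.ne'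
  rw [listRank_eq_sum (hprim.ne_zero ht.ne'), Multiset.length_sort]
  simp only [gbgRank, residueCount, Nat.cast_sum, Finset.sum_mul]
  rw [Finset.sum_comm]
  refine Finset.sum_congr rfl fun i _ => ?_
  simp only [Finset.card_filter, Nat.cast_sum, Finset.sum_mul]
  rw [Finset.sum_comm]
  refine Finset.sum_congr rfl fun c _ => ?_
  have h0 := Int.emod_nonneg ((c : ℤ) - i) htz
  have h1 := Int.emod_lt_of_pos ((c : ℤ) - i) (by exact_mod_cast ht : (0 : ℤ) < t)
  rw [Finset.sum_eq_single (((c : ℤ) - i) % t).toNat]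
  · rw [if_pos (Int.toNat_of_nonneg h0).symm, Nat.cast_one, one_mul, ← zpow_natCast,
      Int.toNat_of_nonneg h0]
    conv_rhs => rw [← Int.emod_add_mul_ediv ((c : ℤ) - i) t]
    rw [zpow_add₀ (hprim.ne_zero ht.ne'), zpow_mul, zpow_natCast ω t, hprim.pow_eq_one, one_zpow,
      mul_one]
  · intro j _ hj
    rw [if_neg (by omega)]
    simp
  · intro h
    rw [mem_range] at h
    omega

open Classical in
theorem genFun_eq_sum {t : ℕ} (ht : 0 < t) (M : ℕ) (k : ℤ) :
    genFun t M k = ∑ L ∈ boundedLists t M,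
      if listRank (Complex.exp (2 * Real.pi * Complex.I / t)) L = k then
        (PowerSeries.X : ℚ⟦X⟧) ^ L.sum else 0 := by
  ext n
  have h : ∀ L : List ℕ, PowerSeries.coeff n
      (if listRank (Complex.exp (2 * Real.pi * Complex.I / t)) L = k then
        (PowerSeries.X : ℚ⟦X⟧) ^ L.sum else 0) =
      if listRank (Complex.exp (2 * Real.pi * Complex.I / t)) L = k ∧ n = L.sum then 1 else 0 := by
    intro L
    split_ifs with h1 h2 h2 <;> simp_all [PowerSeries.coeff_X_pow]
  rw [genFun, PowerSeries.coeff_mk, map_sum, Finset.sum_congr rfl fun L _ => h L,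
    Finset.sum_boole]
  congr 1
  refine Finset.card_bij (fun π _ => π.parts.sort (· ≥ ·)) ?_ ?_ ?_
  · intro π hπ
    rw [mem_filter] at hπ ⊢
    obtain ⟨-, h1, h2, h3⟩ := hπ
    have hcount : ∀ p, (π.parts.sort (· ≥ ·)).count p = π.parts.count p := fun p => by
      rw [← Multiset.coe_count, Multiset.sort_eq]
    refine ⟨(mem_boundedLists ht).mpr ⟨Multiset.pairwise_sort _ _, fun p hp => ?_,
      fun p hp => ?_⟩, ?_, ?_⟩
    · rw [Multiset.mem_sort] at hp
      exact ⟨π.parts_pos hp, h1 p hp⟩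
    · rw [Multiset.mem_sort] at hp
      have := h2 p hp
      rw [hcount]
      omega
    · rw [← gbgRank_eq_listRank ht, h3]
    · rw [← Multiset.sum_coe, Multiset.sort_eq, π.parts_sum]
  · intro π _ π' _ h
    apply Nat.Partition.ext
    rw [← Multiset.sort_eq π.parts (· ≥ ·), h, Multiset.sort_eq]
  · intro L hL
    rw [mem_filter, mem_boundedLists ht] at hL
    obtain ⟨⟨h1, h2, h3⟩, h4, h5⟩ := hL
    let π : n.Partition := ⟨(L : Multiset ℕ), fun {p} hp => (h2 p (Multiset.mem_coe.mp hp)).1, by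
      rw [Multiset.sum_coe, h5]⟩
    have hsort : π.parts.sort (· ≥ ·) = L :=
      List.Perm.eq_of_pairwise' (Multiset.pairwise_sort _ _) h1
        (Multiset.coe_eq_coe.mp (Multiset.sort_eq _ _))
    refine ⟨π, ?_, hsort⟩
    rw [mem_filter]
    refine ⟨mem_univ _, fun p hp => (h2 p (Multiset.mem_coe.mp hp)).2, fun p hp => ?_, ?_⟩
    · have := h3 p (Multiset.mem_coe.mp hp)
      rw [← Multiset.coe_count] at this
      exact Nat.le_sub_one_of_lt this
    · rw [gbgRank_eq_listRank ht, hsort, h4]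

/-- For a partition with row lengths `L` at most `M`, this is the sum of `ω ^ (-b)` over its set
of beads, that is over the `M` numbers `b = h + M - 1 - c`, where `h` is the height of
column `c < M`. -/
def beadSum (ω : ℂ) (M : ℕ) (L : List ℕ) : ℂ :=
  ∑ a ∈ range M, ω⁻¹ ^ a - listRank ω L * ω⁻¹ ^ M * (ω - 1)

theorem beadSum_cons {ω : ℂ} (hω : ω ≠ 0) (M : ℕ) (L : List ℕ) :
    beadSum ω M (M :: L) = ω⁻¹ * beadSum ω M L := by
  have h1 := geom_sum_mul ω M
  have h2 : ω⁻¹ ^ M * ω ^ M = 1 := by rw [← mul_pow, inv_mul_cancel₀ hω, one_pow]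
  have h3 := geom_sum_mul ω⁻¹ M
  simp only [beadSum, listRank]
  linear_combination (-ω⁻¹ ^ M) * h1 - h2 - h3

theorem beadSum_replicate_append {ω : ℂ} (hω : ω ≠ 0) (M : ℕ) (L : List ℕ) (j : ℕ) :
    beadSum ω M (List.replicate j M ++ L) = ω⁻¹ ^ j * beadSum ω M L := by
  induction j with
  | zero => simp
  | succ j ih => rw [List.replicate_succ, List.cons_append, beadSum_cons hω, ih]; ring

theorem beadSum_succ (ω : ℂ) (M : ℕ) (L : List ℕ) :
    beadSum ω (M + 1) L = 1 + ω⁻¹ * beadSum ω M L := by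
  simp only [beadSum]
  rw [Finset.sum_range_succ']
  simp only [pow_succ', ← Finset.mul_sum, pow_zero]
  ring

/-- The value at `ω⁻¹` of the counting function `m` on residues. -/
def residueSum (ω : ℂ) {t : ℕ} [NeZero t] (m : ZMod t → ℤ) : ℂ :=
  ∑ u, (m u : ℂ) * ω⁻¹ ^ u.val

theorem pow_val_add {t : ℕ} [NeZero t] {z : ℂ} (hz : z ^ t = 1) (u : ZMod t) (j : ℕ) :
    z ^ (u + j).val = z ^ u.val * z ^ j := by
  rw [ZMod.val_add, ZMod.val_natCast, Nat.add_mod_mod, ← pow_eq_pow_mod _ hz, pow_add]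

theorem residueSum_shift {t : ℕ} [NeZero t] {ω : ℂ} (hω : ω ^ t = 1) (m : ZMod t → ℤ) (j : ℕ) :
    ω⁻¹ ^ j * residueSum ω (fun u : ZMod t => m (u + j)) = residueSum ω m := by
  rw [residueSum, residueSum, Finset.mul_sum]
  refine Fintype.sum_equiv (Equiv.addRight (j : ZMod t)) _ _ fun u => ?_
  rw [Equiv.coe_addRight, pow_val_add (by rw [inv_pow, hω, inv_one])]
  ring

theorem residueSum_sub (ω : ℂ) {t : ℕ} [NeZero t] (m m' : ZMod t → ℤ) :
    residueSum ω (fun u => m u - m' u) = residueSum ω m - residueSum ω m' := by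
  simp only [residueSum, ← Finset.sum_sub_distrib]
  exact Finset.sum_congr rfl fun u _ => by push_cast; ring

theorem residueSum_single (ω : ℂ) {t : ℕ} [NeZero t] (a : ZMod t) :
    residueSum ω (fun u => if u = a then 1 else 0) = ω⁻¹ ^ a.val := by
  simp [residueSum]

theorem beadSum_eq_residueSum_iff {t : ℕ} [NeZero t] {ω : ℂ} (hω0 : ω ≠ 0) (hω : ω ^ t = 1)
    (M j : ℕ) (L : List ℕ) (m : ZMod t → ℤ) :
    beadSum ω (M + 1) (List.replicate j (M + 1) ++ L) = residueSum ω m ↔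
      beadSum ω M L = residueSum ω (fun u : ZMod t => m (u + 1 + j) - if u + 1 = 0 then 1 else 0) := by
  have h1 := residueSum_shift hω m j
  have h2 := residueSum_shift hω (fun u : ZMod t => m (u + j) - if u = 0 then 1 else 0) 1
  have h3 := residueSum_single ω (0 : ZMod t)
  rw [residueSum_sub ω (fun u : ZMod t => m (u + j)) (fun u => if u = 0 then 1 else 0), h3,
    ZMod.val_zero, pow_zero, pow_one, Nat.cast_one] at h2
  rw [beadSum_replicate_append hω0, ← h1, beadSum_succ]
  have h4 : residueSum ω (fun u : ZMod t => m (u + j)) =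
      1 + ω⁻¹ * residueSum ω (fun u : ZMod t => m (u + 1 + j) - if u + 1 = 0 then 1 else 0) := by
    rw [h2]; ring
  rw [h4, mul_right_inj' (pow_ne_zero _ (inv_ne_zero hω0)), add_right_inj,
    mul_right_inj' (inv_ne_zero hω0)]

open Polynomial in
theorem eq_zero_of_residueSum_eq_zero {t : ℕ} [NeZero t] (ht : t.Prime) {ω : ℂ}
    (hω : IsPrimitiveRoot ω t) {m : ZMod t → ℤ} (hsum : ∑ u, m u = 0)
    (h : residueSum ω m = 0) : m = 0 := by
  have : Fact t.Prime := ⟨ht⟩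
  let p : ℤ[X] := ∑ u : ZMod t, C (m u) * X ^ u.val
  have hp : aeval ω⁻¹ p = 0 := by
    rw [← h]
    simp [p, residueSum]
  have hcoeff : ∀ u : ZMod t, p.coeff u.val = m u := by
    intro u
    simp only [p, finsetSum_coeff, coeff_C_mul, coeff_X_pow]
    rw [Finset.sum_eq_single u]
    · simp
    · intro v _ hv
      rw [if_neg fun e => hv (ZMod.val_injective t e.symm), mul_zero]
    · simp
  have hdvd : cyclotomic t ℤ ∣ p := by
    rw [cyclotomic_eq_minpoly hω.inv ht.pos]
    exact minpoly.isIntegrallyClosed_dvd (hω.inv.isIntegral ht.pos) hp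
  obtain ⟨c, hc⟩ := hdvd
  have hp0 : p = 0 := by
    by_contra hne
    have hdeg : p.natDegree < t := by
      have : p.natDegree ≤ t - 1 := natDegree_sum_le_of_forall_le _ _ fun u _ =>
        (natDegree_C_mul_X_pow_le _ _).trans (Nat.le_sub_one_of_lt (ZMod.val_lt u))
      have := ht.pos
      omega
    have hc0 : c ≠ 0 := by rintro rfl; exact hne (by rw [hc, mul_zero])
    rw [hc, natDegree_mul (cyclotomic_ne_zero t ℤ) hc0, natDegree_cyclotomic,
      Nat.totient_prime ht] at hdeg
    have hcd : c.natDegree = 0 := by omega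
    have heval : p.eval 1 = 0 := by
      rw [← hsum]
      simp [p, eval_finsetSum]
    rw [hc, eval_mul, eval_one_cyclotomic_prime, eq_C_of_natDegree_eq_zero hcd, eval_C] at heval
    have : c.coeff 0 = 0 := by
      rcases mul_eq_zero.mp heval with h | h
      · exact absurd h (by exact_mod_cast ht.ne_zero)
      · exact h
    exact hc0 (by rw [eq_C_of_natDegree_eq_zero hcd, this, C_0])
  funext u
  rw [← hcoeff u, hp0, coeff_zero, Pi.zero_apply]

theorem beadWeight_of_sum_eq_zero {t : ℕ} [NeZero t] {m : ZMod t → ℤ} (hsum : ∑ u, m u = 0) :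
    beadWeight t m = if m = 0 then 1 else 0 := by
  split_ifs with h
  · subst h
    refine Finset.prod_eq_one fun u _ => ?_
    simp [runnerWeight, qPochInv_zero]
  · obtain ⟨u, hu⟩ : ∃ u, m u < 0 := by
      by_contra! hnn
      exact h (funext fun u => (Finset.sum_eq_zero_iff_of_nonneg fun u _ => hnn u).mp hsum u
        (mem_univ u))
    exact beadWeight_of_neg hu

theorem sum_rotate_sub {t : ℕ} [NeZero t] (m : ZMod t → ℤ) (j : ZMod t) :
    ∑ u : ZMod t, (m (u + 1 + j) - if u + 1 = 0 then 1 else 0) = ∑ u, m u - 1 := by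
  have h1 : ∑ u : ZMod t, m (u + 1 + j) = ∑ u, m u :=
    Fintype.sum_equiv ((Equiv.addRight 1).trans (Equiv.addRight j)) _ _ fun u => by simp
  have h2 : ∑ u : ZMod t, (if u + 1 = 0 then (1 : ℤ) else 0) =
      ∑ u : ZMod t, if u = 0 then 1 else 0 :=
    Fintype.sum_equiv (Equiv.addRight 1) _ _ fun u => rfl
  rw [Finset.sum_sub_distrib, h1, h2]
  simp

open Classical in
/-- The generating function of the partitions with parts at most `M`, multiplicities less than
`t` and prescribed numbers of beads in the residue classes modulo `t`. -/
theorem X_pow_mul_sum_boundedLists {t : ℕ} [NeZero t] (ht : t.Prime) {ω : ℂ}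
    (hω : IsPrimitiveRoot ω t) (M : ℕ) : ∀ m : ZMod t → ℤ, ∑ u, m u = M →
    PowerSeries.X ^ (M.choose 2) * ∑ L ∈ boundedLists t M,
        (if beadSum ω M L = residueSum ω m then (PowerSeries.X : ℚ⟦X⟧) ^ L.sum else 0) =
      qPoch (PowerSeries.X ^ t) (PowerSeries.X ^ t) M * beadWeight t m := by
  induction M with
  | zero =>
    intro m hm
    rw [Nat.cast_zero] at hm
    have h : (0 : ℂ) = residueSum ω m ↔ m = 0 := by
      constructor
      · exact fun h => eq_zero_of_residueSum_eq_zero ht hω hm h.symm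
      · rintro rfl; simp [residueSum]
    rw [beadWeight_of_sum_eq_zero hm]
    simp [boundedLists, beadSum, listRank, qPoch, h]
  | succ M ih =>
    intro m hm
    rw [sum_boundedLists_succ ht.pos, qPoch_succ]
    have e : (PowerSeries.X ^ t : ℚ⟦X⟧) * (PowerSeries.X ^ t) ^ M =
        PowerSeries.X ^ (t * (M + 1)) := by ring
    rw [e, mul_assoc, ← sum_beadWeight_rotations t M m hm, Finset.mul_sum, Finset.mul_sum]
    refine Finset.sum_congr rfl fun j _ => ?_
    have hm' : ∑ u : ZMod t, (m (u + 1 + j) - if u + 1 = 0 then 1 else 0) = (M : ℤ) := by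
      rw [sum_rotate_sub, hm]
      push_cast
      ring
    have key := ih _ hm'
    calc _ = PowerSeries.X ^ ((M + 1) * j) * (PowerSeries.X ^ M * (PowerSeries.X ^ (M.choose 2) *
          ∑ L ∈ boundedLists t M, (if beadSum ω M L =
            residueSum ω (fun u : ZMod t => m (u + 1 + j) - if u + 1 = 0 then 1 else 0) then
              (PowerSeries.X : ℚ⟦X⟧) ^ L.sum else 0))) := by
          simp only [Finset.mul_sum]
          refine Finset.sum_congr rfl fun L _ => ?_
          simp only [beadSum_eq_residueSum_iff (hω.ne_zero ht.ne_zero) hω.pow_eq_one]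
          split_ifs
          · rw [List.sum_append, List.sum_replicate, Nat.choose_succ_succ' M 1,
              Nat.choose_one_right, smul_eq_mul]
            ring
          · simp
      _ = _ := by rw [key]; ring

@[to_additive]
theorem prod_zmod_val {R : Type*} [CommMonoid R] (t : ℕ) [NeZero t] (f : ℕ → R) :
    ∏ u : ZMod t, f u.val = ∏ i ∈ range t, f i := by
  obtain ⟨s, rfl⟩ : ∃ s, t = s + 1 := ⟨t - 1, by have := NeZero.pos t; omega⟩
  exact Fin.prod_univ_eq_prod_range f (s + 1)

/-- The residue modulo `t` of `ν - 1`, for `ν < t`. -/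
def predResidue (t ν : ℕ) : ℕ := if ν = 0 then t - 1 else ν - 1

/-- The number of beads in the residue class of `i < t` for a partition with parts at most
`t N + ν` and GBG-rank `k`. -/
def rankBeads (t N ν : ℕ) (k : ℤ) (i : ℕ) : ℤ :=
  N + (if i < ν then 1 else 0) + (if i = ν then k else 0) -
    (if i = predResidue t ν then k else 0)

theorem predResidue_lt {t ν : ℕ} (ht : 2 ≤ t) (hν : ν < t) : predResidue t ν < t := by
  unfold predResidue; split_ifs <;> omega

theorem predResidue_ne {t ν : ℕ} (ht : 2 ≤ t) : predResidue t ν ≠ ν := by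
  unfold predResidue; split_ifs <;> omega

theorem sum_range_ite_lt {R : Type*} [AddCommMonoid R] {t ν : ℕ} (hν : ν < t) (f : ℕ → R) :
    ∑ i ∈ range t, (if i < ν then f i else 0) = ∑ i ∈ range ν, f i := by
  rw [← Finset.sum_filter]
  congr 1
  ext i
  simp only [mem_filter, mem_range]
  omega

theorem sum_rankBeads {t N ν : ℕ} (ht : 2 ≤ t) (hν : ν < t) (k : ℤ) :
    ∑ i ∈ range t, rankBeads t N ν k i = (t * N + ν : ℕ) := by
  simp only [rankBeads, Finset.sum_sub_distrib, Finset.sum_add_distrib]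
  rw [sum_range_ite_lt hν (fun _ => (1 : ℤ))]
  simp [predResidue_lt ht hν, hν]

theorem sum_rankBeads_mul_pow {t N ν : ℕ} (ht : 2 ≤ t) (hν : ν < t) (k : ℤ) {z : ℂ}
    (hz : IsPrimitiveRoot z t) :
    ∑ i ∈ range t, (rankBeads t N ν k i : ℂ) * z ^ i =
      ∑ a ∈ range (t * N + ν), z ^ a + k * z ^ (t * N + ν) * (1 - z⁻¹) := by
  have h1 : z - 1 ≠ 0 := sub_ne_zero.mpr (hz.ne_one (by omega))
  have hz0 : z ≠ 0 := hz.ne_zero (by omega)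
  have hpow : z ^ (t * N + ν) = z ^ ν := by rw [pow_add, pow_mul, hz.pow_eq_one, one_pow, one_mul]
  have hgeom : ∑ a ∈ range (t * N + ν), z ^ a = ∑ a ∈ range ν, z ^ a := by
    apply mul_right_cancel₀ h1
    rw [geom_sum_mul, geom_sum_mul, hpow]
  have hpred : z ^ predResidue t ν = z ^ ν * z⁻¹ := by
    rw [eq_mul_inv_iff_mul_eq₀ hz0, ← pow_succ]
    unfold predResidue
    split_ifs with h
    · rw [Nat.sub_add_cancel (by omega), h, hz.pow_eq_one, pow_zero]
    · rw [Nat.sub_add_cancel (by omega)]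
  have hterm : ∀ i, (rankBeads t N ν k i : ℂ) * z ^ i = N * z ^ i + (if i < ν then z ^ i else 0) +
      (if i = ν then k * z ^ i else 0) - (if i = predResidue t ν then k * z ^ i else 0) := by
    intro i
    simp only [rankBeads]
    push_cast
    split_ifs <;> ring
  rw [Finset.sum_congr rfl fun i _ => hterm i, Finset.sum_sub_distrib, Finset.sum_add_distrib,
    Finset.sum_add_distrib, ← Finset.mul_sum, hz.geom_sum_eq_zero (by omega),
    sum_range_ite_lt hν, Finset.sum_ite_eq', Finset.sum_ite_eq', if_pos (mem_range.mpr hν),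
    if_pos (mem_range.mpr (predResidue_lt ht hν)), hgeom, hpred, hpow]
  ring

theorem beadSum_eq_iff_listRank_eq {t N ν : ℕ} [NeZero t] (ht : 2 ≤ t) (hν : ν < t) (k : ℤ)
    {ω : ℂ} (hω : IsPrimitiveRoot ω t) (L : List ℕ) :
    beadSum ω (t * N + ν) L = residueSum ω (fun u : ZMod t => rankBeads t N ν k u.val) ↔
      listRank ω L = k := by
  have h0 : ω ≠ 0 := hω.ne_zero (by omega)
  have h1 : ω - 1 ≠ 0 := sub_ne_zero.mpr (hω.ne_one (by omega))
  have h2 := sum_rankBeads_mul_pow (N := N) ht hν k hω.inv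
  rw [residueSum, sum_zmod_val t (fun i => (rankBeads t N ν k i : ℂ) * ω⁻¹ ^ i), h2, beadSum,
    inv_inv]
  set P := ω⁻¹ ^ (t * N + ν)
  have hP : P * (ω - 1) ≠ 0 := mul_ne_zero (pow_ne_zero _ (inv_ne_zero h0)) h1
  constructor
  · intro h
    apply mul_right_cancel₀ hP
    linear_combination -h
  · rintro h
    rw [h]
    ring

theorem two_mul_choose_two (n : ℕ) : (2 : ℤ) * (n.choose 2 : ℕ) = n * (n - 1) := by
  induction n with
  | zero => simp
  | succ n ih =>
    rw [Nat.choose_succ_succ' n 1, Nat.choose_one_right]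
    push_cast
    linarith

theorem sum_rankBeads_energy {t N ν : ℕ} (ht : 2 ≤ t) (hν : ν < t) (k : ℤ) :
    ∑ i ∈ range t, (2 * i * rankBeads t N ν k i +
        t * (rankBeads t N ν k i * (rankBeads t N ν k i - 1))) =
      ((t * N + ν : ℕ) : ℤ) * ((t * N + ν : ℕ) - 1) + 2 * (t * k ^ 2 - (t - 1) * k) := by
  have hne := predResidue_ne (ν := ν) ht
  have hterm : ∀ i : ℕ, (2 * i * rankBeads t N ν k i +
        t * (rankBeads t N ν k i * (rankBeads t N ν k i - 1))) =
      N * (i * 2 : ℤ) + (t * (N * (N - 1)) : ℤ) +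
        (if i < ν then (i * 2 : ℤ) + 2 * t * N else 0) +
        (if i = ν then 2 * ν * k + t * (2 * N * k + k ^ 2 - k) else 0) +
        (if i = predResidue t ν then -2 * i * k +
          t * (-2 * (N + if i < ν then 1 else 0) * k + k ^ 2 + k) else 0) := by
    intro i
    simp only [rankBeads]
    by_cases h1 : i = ν
    · subst h1
      simp only [if_neg hne.symm, lt_irrefl, if_true, if_false]
      ring
    · by_cases h2 : i = predResidue t ν
      · simp only [if_neg h1, if_pos h2]
        split_ifs <;> ring
      · simp only [if_neg h1, if_neg h2]
        split_ifs <;> ring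
  have gauss : ∀ n : ℕ, ∑ i ∈ range n, (i * 2 : ℤ) = n * (n - 1) := by
    intro n
    induction n with
    | zero => simp
    | succ n ih => rw [Finset.sum_range_succ, ih]; push_cast; ring
  rw [Finset.sum_congr rfl fun i _ => hterm i]
  simp only [Finset.sum_add_distrib]
  rw [sum_range_ite_lt hν, Finset.sum_ite_eq', Finset.sum_ite_eq', if_pos (mem_range.mpr hν),
    if_pos (mem_range.mpr (predResidue_lt ht hν)), ← Finset.mul_sum, gauss,
    Finset.sum_add_distrib, gauss]
  simp only [Finset.sum_const, card_range, nsmul_eq_mul]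
  unfold predResidue
  by_cases h : ν = 0
  · subst h
    rw [if_pos rfl, if_neg (Nat.not_lt_zero _)]
    push_cast [Nat.cast_sub (by omega : 1 ≤ t)]
    ring
  · rw [if_neg h, if_pos (by omega)]
    push_cast [Nat.cast_sub (by omega : 1 ≤ ν)]
    ring

theorem beadWeight_rankBeads {t N ν : ℕ} [NeZero t] (ht : 2 ≤ t) (hν : ν < t) (k : ℤ) :
    beadWeight t (fun u => rankBeads t N ν k u.val) =
      PowerSeries.X ^ ((t * N + ν).choose 2) *
        PowerSeries.X ^ ((t : ℤ) * k ^ 2 - ((t : ℤ) - 1) * k).toNat *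
        ∏ i ∈ range t, qPochInv t (rankBeads t N ν k i) := by
  rw [beadWeight, prod_zmod_val t fun i => runnerWeight t i (rankBeads t N ν k i)]
  by_cases hneg : ∃ i ∈ range t, rankBeads t N ν k i < 0
  · obtain ⟨i, hi, h⟩ := hneg
    rw [Finset.prod_eq_zero hi (runnerWeight_of_neg h), Finset.prod_eq_zero hi (qPochInv_of_neg h),
      mul_zero]
  push Not at hneg
  rw [Finset.prod_congr rfl fun i hi => runnerWeight_of_nonneg (hneg i hi), Finset.prod_mul_distrib,
    Finset.prod_pow_eq_pow_sum, ← pow_add]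
  congr 2
  have h1 := sum_rankBeads_energy (N := N) ht hν k
  have h2 := two_mul_choose_two (t * N + ν)
  have h3 := Int.toNat_of_nonneg (exponent_nonneg t (by omega) k)
  have h4 : 2 * ∑ i ∈ range t, ((i * (rankBeads t N ν k i).toNat +
        t * (rankBeads t N ν k i).toNat.choose 2 : ℕ) : ℤ) =
      ∑ i ∈ range t, (2 * i * rankBeads t N ν k i +
        t * (rankBeads t N ν k i * (rankBeads t N ν k i - 1))) := by
    rw [Finset.mul_sum]
    refine Finset.sum_congr rfl fun i hi => ?_
    have h5 := two_mul_choose_two (rankBeads t N ν k i).toNat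
    rw [Int.toNat_of_nonneg (hneg i hi)] at h5
    rw [← h5, Nat.cast_add, Nat.cast_mul, Nat.cast_mul, Int.toNat_of_nonneg (hneg i hi)]
    ring
  apply Nat.cast_injective (R := ℤ)
  rw [Nat.cast_sum, Nat.cast_add]
  linarith

theorem ceil_sub_div {t ν i : ℕ} (hν : ν < t) (hi : i < t) :
    ⌈((ν : ℚ) - (i : ℚ)) / (t : ℚ)⌉ = if i < ν then 1 else 0 := by
  have ht : (0 : ℚ) < t := by exact_mod_cast (by omega : 0 < t)
  have hν' : (ν : ℚ) < t := by exact_mod_cast hν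
  have hi' : (i : ℚ) < t := by exact_mod_cast hi
  have hν0 : (0 : ℚ) ≤ ν := Nat.cast_nonneg _
  have hi0 : (0 : ℚ) ≤ i := Nat.cast_nonneg _
  rw [Int.ceil_eq_iff, lt_div_iff₀ ht, div_le_iff₀ ht]
  split_ifs with h
  · have : (i : ℚ) < ν := by exact_mod_cast h
    push_cast
    constructor <;> linarith
  · have : (ν : ℚ) ≤ i := by exact_mod_cast not_lt.mp h
    push_cast
    constructor <;> linarith

theorem prod_rankBeads {R : Type*} [CommMonoid R] {t N ν : ℕ} (ht : 2 ≤ t) (hν : ν < t) (k : ℤ)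
    (g : ℤ → R) :
    ∏ i ∈ range t, g (rankBeads t N ν k i) =
      g ((N : ℤ) + ⌈(ν : ℚ) / (t : ℚ)⌉ - k) *
        (∏ i ∈ Icc 1 (t - 2), g ((N : ℤ) + ⌈((ν : ℚ) - (i : ℚ)) / (t : ℚ)⌉)) *
        g ((N : ℤ) + k) := by
  let F : ℕ → ℤ := fun i => N + (if i < ν then 1 else 0) - (if i = 0 then k else 0) +
    (if i = t - 1 then k else 0)
  let σ : ℕ → ℕ := fun i => if i < ν then ν - 1 - i else ν + t - 1 - i
  have hσ : ∀ i ∈ range t, σ i ∈ range t := by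
    intro i hi
    rw [mem_range] at hi ⊢
    simp only [σ]
    split_ifs <;> omega
  have hσσ : ∀ i ∈ range t, σ (σ i) = i := by
    intro i hi
    rw [mem_range] at hi
    simp only [σ]
    split_ifs <;> omega
  have h1 : ∏ i ∈ range t, g (rankBeads t N ν k i) = ∏ i ∈ range t, g (F i) := by
    refine Finset.prod_nbij' σ σ hσ hσ hσσ hσσ fun i hi => ?_
    rw [mem_range] at hi
    congr 1
    simp only [rankBeads, predResidue, F, σ]
    split_ifs <;> omega
  have h0 : ⌈(ν : ℚ) / (t : ℚ)⌉ = if 0 < ν then 1 else 0 := by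
    rw [← ceil_sub_div hν (by omega : 0 < t), Nat.cast_zero, sub_zero]
  have h2 : ∏ i ∈ Icc 1 (t - 2), g ((N : ℤ) + ⌈((ν : ℚ) - (i : ℚ)) / (t : ℚ)⌉) =
      ∏ i ∈ Icc 1 (t - 2), g (F i) := by
    refine Finset.prod_congr rfl fun i hi => ?_
    rw [mem_Icc] at hi
    rw [ceil_sub_div hν (by omega)]
    congr 1
    simp only [F]
    split_ifs <;> omega
  have hF0 : (N : ℤ) + (if 0 < ν then 1 else 0) - k = F 0 := by
    simp only [F]
    split_ifs <;> omega
  have hFt : (N : ℤ) + k = F (t - 1) := by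
    simp only [F]
    split_ifs <;> omega
  rw [h1, h0, h2, hF0, hFt]
  obtain ⟨s, rfl⟩ : ∃ s, t = s + 2 := ⟨t - 2, by omega⟩
  rw [Finset.prod_range_succ, Finset.prod_range_succ', mul_comm _ (g (F 0))]
  have h3 : Icc 1 (s + 2 - 2) = Ico 1 (s + 1) := by ext; simp only [mem_Icc, mem_Ico]; omega
  rw [h3, Finset.prod_Ico_eq_prod_range]
  simp only [add_comm 1, Nat.add_sub_cancel]
  rfl

end GBG

open GBG in
theorem theorem2p4 (t : ℕ) (ht : t.Prime) (N : ℕ) (k : ℤ) (ν : ℕ) (hν : ν < t) :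
    GBG.genFun t (t * N + ν) k =
      PowerSeries.X ^ ((t : ℤ) * k ^ 2 - ((t : ℤ) - 1) * k).toNat *
        GBG.qPoch (PowerSeries.X ^ t) (PowerSeries.X ^ t) (t * N + ν) *
        (GBG.qPochInv t ((N : ℤ) + ⌈(ν : ℚ) / (t : ℚ)⌉ - k) *
          (∏ i ∈ Finset.Icc 1 (t - 2),
            GBG.qPochInv t ((N : ℤ) + ⌈((ν : ℚ) - (i : ℚ)) / (t : ℚ)⌉)) *
          GBG.qPochInv t ((N : ℤ) + k)) := by
  have : NeZero t := ⟨ht.ne_zero⟩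
  have hω := Complex.isPrimitiveRoot_exp t ht.ne_zero
  have hsum : ∑ u : ZMod t, rankBeads t N ν k u.val = (t * N + ν : ℕ) := by
    rw [sum_zmod_val t, sum_rankBeads ht.two_le hν]
  have hmain := X_pow_mul_sum_boundedLists ht hω (t * N + ν) _ hsum
  simp only [beadSum_eq_iff_listRank_eq ht.two_le hν k hω] at hmain
  rw [beadWeight_rankBeads ht.two_le hν, ← genFun_eq_sum ht.pos] at hmain
  rw [← prod_rankBeads ht.two_le hν k]
  apply mul_left_cancel₀ (pow_ne_zero ((t * N + ν).choose 2) (PowerSeries.X_ne_zero (R := ℚ)))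
  rw [hmain]
  ring

end
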